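/- Let $n,d\ge 1$ be integers and let $\mathcal B_{n,2d}$ be the space of real forms of degree $2d$ in $x_1,\dots,x_n$, with the basis $\mathsf B_{n,2d}=\{x^\alpha:\alpha\in\mathbb N_0^n,\ |\alpha|=2d\}$ and $m=|\mathsf B_{n,2d}|$. - The real Waring rank $w(n,2d)$ is the smallest number such that each $f\in\mathcal B_{n,2d}$ can be written as $f(x)=\sum_{i=1}^k c_i(\lambda_i\cdot x)^{2d}$ with $k\le w(n,2d)$, $c_i\in\mathbb R$, $\lambda_i\in\mathbb R^n$. - The signed Carathéodory number $\mathcal C_{\mathsf B_{n,2d},\pm}$ is the smallest number such that for each $s=(s_\alpha)\in\mathbb R^m$ there are $k\le\mathcal C_{\mathsf B_{n,2d},\pm}$, pairwise different points $x_1,\dots,x_k$ of real projective space (realized as the set $S^{n-1}_+$ of unit vectors in $\mathbb R^n$ whose first nonvanishing coordinate is positive) and nonzero reals $c_1,\dots,c_k$ with $s_\alpha=\sum_{i=1}^k c_i x_i^\alpha$ for all $|\alpha|=2d$. - For $C=(c_1,\dots,c_k)\in\mathbb R^k$ and $X=(x_1,\dots,x_k)\in(\mathbb R^n)^k$ let $S_k(C,X)=\big(\sum_{i=1}^k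 c_i x_i^\alpha\big)_{|\alpha|=2d}\in\mathbb R^m$, with total derivative $DS_k(C,X)$. The number $N=\mathcal N_{\mathsf B_{n,2d}}$ is the smallest $k\ge1$ such that $DS_k(C,X)$ has rank $m$ for some $(C,X)$ with $C\ge 0$. These three minima exist, and the following hold. (i) $w(n,2d)=\mathcal C_{\mathsf B_{n,2d},\pm}$. (ii) $\mathcal N_{\mathsf B_{n,2d}}\le w(n,2d)\le 2\,\mathcal N_{\mathsf B_{n,2d}}$. (iii) There exists $\lambda=(\lambda_1,\dots,\lambda_N)\in\mathbb R^{N\cdot n}$ such that for all $\varepsilon>0$ and $p\in\mathcal B_{n,2d}$ we have $$p(x)=c\cdot\sum_{i=1}^{N}\big[(\lambda_i\cdot x)^{2d}-c_i(\lambda_i^\varepsilon\cdot x)^{2d}\big]$$ for some $c\in\mathbb R$, some $\lambda^\varepsilon=(\lambda_1^\varepsilon,\dots,\lambda_N^\varepsilon)$ with $\|\lambda-\lambda^\varepsilon\|<\varepsilon$ and some reals $c_i$ with $|1-c_i|<\varepsilon$. (iv) Every $\lambda\in\mathbb R^{N\cdot n}$ at which $DS_N((1,\dots,1),\lambda)$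 has full rank $m$ has the property in (iii), and the set of these vectors $\lambda$ is open and dense in $\mathbb R^{N\cdot n}$. -/

import Mathlib

/-- The map `(C, X) ↦ ∑ i, c_i s(x_i)`, where `s(x) = (f_j(x))_j` is the moment curve of the
family `f`: it sends coefficients `C = (c_1, …, c_k)` and points `X = (x_1, …, x_k)` to the moment
sequence of `∑ i, c_i δ_{x_i}`. -/
def momentMap {ι 𝓧 : Type*} (f : ι → 𝓧 → ℝ) (k : ℕ)
    (P : (Fin k → ℝ) × (Fin k → 𝓧)) : ι → ℝ :=
  fun j => ∑ i, P.1 i * f j (P.2 i)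

/-- The sequence `s` has a signed `k`-atomic representing measure `∑ i, c_i δ_{x_i}` on `𝓧`:
the atoms `x_i` are pairwise different and the coefficients `c_i` are nonzero. -/
def HasSignedAtomicMeasure {ι 𝓧 : Type*} (f : ι → 𝓧 → ℝ) (k : ℕ) (s : ι → ℝ) : Prop :=
  ∃ (c : Fin k → ℝ) (x : Fin k → 𝓧),
    (∀ i, c i ≠ 0) ∧ Function.Injective x ∧ momentMap f k (c, x) = s

/-- All `K` such that every real sequence `s` has a signed `k`-atomic representing measure with
`k ≤ K`. -/
def signedCaratheodoryBounds {ι 𝓧 : Type*} (f : ι → 𝓧 → ℝ) : Set ℕ :=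
  {K | ∀ s : ι → ℝ, ∃ k ≤ K, HasSignedAtomicMeasure f k s}

/-- The signed Carathéodory number of the family `f` on `𝓧`. -/
noncomputable def signedCaratheodoryNumber {ι 𝓧 : Type*} (f : ι → 𝓧 → ℝ) : ℕ :=
  sInf (signedCaratheodoryBounds f)

/-- For functions `f_j` on `ℝⁿ`: the total derivative of `momentMap f k`, with respect to all
coefficients and all coordinates of all points, has full rank `|ι|` at `P = (C, X)`. -/
def HasFullRankAt {ι : Type*} [Fintype ι] {n : ℕ} (f : ι → (Fin n → ℝ) → ℝ) (k : ℕ)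
    (P : (Fin k → ℝ) × (Fin k → Fin n → ℝ)) : Prop :=
  Module.finrank ℝ (LinearMap.range (fderiv ℝ (momentMap f k) P).toLinearMap) = Fintype.card ι

/-- All `k ≥ 1` such that the total derivative of the moment map has full rank at some `(C, X)`
with `C ≥ 0`. -/
def fullRankNumbers {ι : Type*} [Fintype ι] {n : ℕ} (f : ι → (Fin n → ℝ) → ℝ) : Set ℕ :=
  {k | 1 ≤ k ∧ ∃ P : (Fin k → ℝ) × (Fin k → Fin n → ℝ), (∀ i, 0 ≤ P.1 i) ∧ HasFullRankAt f k P}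

/-- The smallest number of atoms for which the total derivative attains full rank. -/
noncomputable def fullRankNumber {ι : Type*} [Fintype ι] {n : ℕ}
    (f : ι → (Fin n → ℝ) → ℝ) : ℕ :=
  sInf (fullRankNumbers f)

/-- The exponents `α ∈ ℕ₀ⁿ` with `|α| = e`. -/
abbrev Exponent (n e : ℕ) : Type :=
  {α : Fin n → ℕ // α ∈ Finset.piAntidiag (Finset.univ : Finset (Fin n)) e}

/-- The membership in `Exponent n e` is the condition `|α| = e`. -/
theorem mem_exponent_iff (n e : ℕ) (α : Fin n → ℕ) :
    α ∈ Finset.piAntidiag (Finset.univ : Finset (Fin n)) e ↔ ∑ i, α i = e := by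
  simp

/-- The monomials `x^α`, `|α| = e`, as functions on `ℝⁿ`. -/
def monomialFun (n e : ℕ) (α : Exponent n e) (x : Fin n → ℝ) : ℝ :=
  ∏ i, x i ^ α.1 i

/-- Real projective space, realized as the set of points of the unit sphere of `ℝⁿ` whose first
nonvanishing coordinate is positive. -/
def HalfSphere (n : ℕ) : Type :=
  {x : Fin n → ℝ // ∑ i, x i ^ 2 = 1 ∧ ∃ i, 0 < x i ∧ ∀ j < i, x j = 0}

/-- The monomials `x^α`, `|α| = e`, as functions on projective space (the half sphere). -/
def projMonomialFun (n e : ℕ) (α : Exponent n e) (x : HalfSphere n) : ℝ :=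
  monomialFun n e α x.1

/-- The linear form `v · x = v_1 x_1 + ⋯ + v_n x_n`. -/
noncomputable def linForm {n : ℕ} (v : Fin n → ℝ) : MvPolynomial (Fin n) ℝ :=
  ∑ j, MvPolynomial.C (v j) * MvPolynomial.X j

/-- All `K` such that every real form `f` in `n` variables of degree `e` is a real linear
combination of `k ≤ K` many `e`-th powers of linear forms. -/
def waringBounds (n e : ℕ) : Set ℕ :=
  {K | ∀ f ∈ MvPolynomial.homogeneousSubmodule (Fin n) ℝ e,
    ∃ k ≤ K, ∃ (c : Fin k → ℝ) (l : Fin k → Fin n → ℝ),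
      f = ∑ i, MvPolynomial.C (c i) * linForm (l i) ^ e}

/-- The real Waring rank `w(n, e)`. -/
noncomputable def realWaringRank (n e : ℕ) : ℕ :=
  sInf (waringBounds n e)

/-- For every `ε > 0`, every form `p` of degree `e` is a scalar multiple of
`∑ i, [(l_i · x)^e - c_i (l'_i · x)^e]` for some `l'` with `‖l - l'‖ < ε` (Euclidean norm)
and some `c` with `|1 - c_i| < ε`. -/
def IsWaringBasePoint {n : ℕ} (e N : ℕ) (l : Fin N → Fin n → ℝ) : Prop :=
  ∀ ε : ℝ, 0 < ε → ∀ p ∈ MvPolynomial.homogeneousSubmodule (Fin n) ℝ e,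
    ∃ (l' : Fin N → Fin n → ℝ) (c : Fin N → ℝ) (a : ℝ),
      Real.sqrt (∑ i, ∑ j, (l i j - l' i j) ^ 2) < ε ∧
      (∀ i, |1 - c i| < ε) ∧
      p = MvPolynomial.C a *
        ∑ i, (linForm (l i) ^ e - MvPolynomial.C (c i) * linForm (l' i) ^ e)

/-! Weighting `s_α` by the multinomial coefficient of `α` identifies moment sequences with forms,
and by the multinomial theorem the sequence of `∑ c_i δ_{λ_i}` becomes `∑ c_i (λ_i · x)^e`. Waring
decompositions are thus signed atomic representations. Moving atoms to the half sphere only rescales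
coefficients, and merging equal atoms never increases their number; this gives (i).

Where the derivative at `((1, …, 1), λ)` is onto, the moment map sends neighbourhoods to
neighbourhoods. In every direction `s` it therefore reaches the base value minus `t s` for some `t ≠
0`; solving for `s` gives (iii) and the first half of (iv), and the `2N` powers used give `w ≤ 2N`.
Full rank is detected by nonvanishing of an analytic determinant, so by the identity theorem it
holds on an open dense set.

For `N ≤ w`, the moment map with `w` atoms is a surjective polynomial map. Its components satisfy no
polynomial relation, and the Jacobian criterion in characteristic zero yields a point of full rank.
The coefficients there may be replaced by ones, so the condition `C ≥ 0` costs nothing. -/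

/-! ### Algebraic independence and the Jacobian criterion. -/

/-- A derivation of a domain of characteristic zero that vanishes on a
subalgebra vanishes on every element that is algebraic over this subalgebra. -/
theorem Derivation.eq_zero_of_isAlgebraic {R A : Type*} [CommRing R] [CommRing A] [IsDomain A]
    [CharZero A] [Algebra R A] (D : Derivation R A A) (S : Subalgebra R A)
    (hS : ∀ a ∈ S, D a = 0) {x : A} (hx : IsAlgebraic S x) : D x = 0 := by
  classical
  have hD : ∀ q : Polynomial S,
      D (Polynomial.aeval x q) = Polynomial.aeval x (Polynomial.derivative q) * D x := by
    intro q
    induction q using Polynomial.induction_on' with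
    | add p q hp hq => simp [hp, hq, add_mul]
    | monomial k a =>
      have ha : D (algebraMap S A a) = 0 := hS _ a.2
      simp only [Polynomial.aeval_monomial, Derivation.leibniz, Derivation.leibniz_pow, ha,
        Polynomial.derivative_monomial, smul_eq_mul, map_mul, nsmul_eq_mul]
      rw [_root_.map_natCast (algebraMap S A)]
      ring
  -- Take an annihilating polynomial of least degree: its derivative has smaller degree and is
  -- nonzero in characteristic zero, so it cannot annihilate `x`.
  have hex : ∃ k : ℕ, ∃ q : Polynomial S, q ≠ 0 ∧ Polynomial.aeval x q = 0 ∧ q.natDegree = k := by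
    obtain ⟨q, hq, h0⟩ := hx
    exact ⟨_, q, hq, h0, rfl⟩
  obtain ⟨q, hq, h0, hdeg⟩ := Nat.find_spec hex
  have hpos : q.natDegree ≠ 0 := by
    intro h
    rw [Polynomial.eq_C_of_natDegree_eq_zero h] at h0 hq
    rw [Polynomial.aeval_C] at h0
    apply hq
    have : q.coeff 0 = 0 := Subtype.ext h0
    rw [this, map_zero]
  have hlt : (Polynomial.derivative q).natDegree < Nat.find hex :=
    hdeg ▸ Polynomial.natDegree_derivative_lt hpos
  have hne : Polynomial.aeval x (Polynomial.derivative q) ≠ 0 := by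
    intro h
    have hd : Polynomial.derivative q ≠ 0 := by
      intro hd
      have : CharZero S := ⟨fun a b hab => by
        have : ((a : S) : A) = ((b : S) : A) := congrArg _ hab
        exact_mod_cast this⟩
      exact hpos (Polynomial.derivative_eq_zero.mp hd)
    exact Nat.find_min hex hlt ⟨_, hd, h, rfl⟩
  have := hD q
  rw [h0, map_zero] at this
  exact (mul_eq_zero.mp this.symm).resolve_left hne

theorem MvPolynomial.mkDerivation_eq_sum_pderiv {R σ : Type*} [CommRing R] [Fintype σ]
    (v : σ → MvPolynomial σ R) (p : MvPolynomial σ R) :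
    MvPolynomial.mkDerivation R v p = ∑ j, MvPolynomial.pderiv j p * v j := by
  classical
  have happ : ∀ q : MvPolynomial σ R, (∑ j, v j • MvPolynomial.pderiv (R := R) j) q =
      ∑ j, MvPolynomial.pderiv j q * v j := by
    intro q
    have := map_sum (Derivation.coeFnAddMonoidHom (R := R) (A := MvPolynomial σ R)
      (M := MvPolynomial σ R)) (fun j => v j • MvPolynomial.pderiv (R := R) j) Finset.univ
    refine (congrFun this q).trans ?_
    simp [mul_comm]
  rw [← happ]
  congr 1
  apply MvPolynomial.derivation_ext
  intro i
  rw [MvPolynomial.mkDerivation_X, happ]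
  simp [MvPolynomial.pderiv_X, Pi.single_apply]

/-- The Jacobian criterion: algebraically independent real polynomials have linearly independent
gradients at some point. -/
theorem AlgebraicIndependent.exists_linearIndependent_pderiv {ι σ : Type*} [Fintype σ]
    {F : ι → MvPolynomial σ ℝ} (hF : AlgebraicIndependent ℝ F) :
    ∃ y : σ → ℝ,
      LinearIndependent ℝ (fun i => fun j => MvPolynomial.eval y (MvPolynomial.pderiv j (F i))) := by
  classical
  obtain ⟨B, hFB, hB⟩ := exists_isTranscendenceBasis_superset
    (AlgebraicIndependent.to_subtype_range hF)
  -- `B` and the variables have the same cardinality, the transcendence degree, so the Jacobian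
  -- matrix of `B` is square.
  obtain ⟨e⟩ : Nonempty (B ≃ σ) := by
    have h1 := hB.lift_cardinalMk_eq_trdeg
    rw [MvPolynomial.trdeg_of_isDomain] at h1
    simp only [Cardinal.lift_lift] at h1
    exact Cardinal.lift_mk_eq'.mp (by simpa using h1)
  let J : Matrix σ σ (MvPolynomial σ ℝ) :=
    fun i j => MvPolynomial.pderiv j (e.symm i).1
  -- A kernel vector `v` of the Jacobian defines a derivation that kills `B`, hence everything
  -- algebraic over it, in particular each variable; so `v = 0`.
  have hJ : J.det ≠ 0 := by
    intro hdet
    obtain ⟨v, hv, hJv⟩ := Matrix.exists_mulVec_eq_zero_iff.mpr hdet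
    apply hv
    let D := MvPolynomial.mkDerivation ℝ v
    have hDB : ∀ b ∈ B, D b = 0 := by
      intro b hb
      have := congrFun hJv (e ⟨b, hb⟩)
      simpa [D, MvPolynomial.mkDerivation_eq_sum_pderiv, J, Matrix.mulVec, dotProduct] using this
    have hDS : ∀ a ∈ Algebra.adjoin ℝ B, D a = 0 := by
      intro a ha
      induction ha using Algebra.adjoin_induction with
      | mem x hx => exact hDB x hx
      | algebraMap r => exact D.map_algebraMap r
      | add x y _ _ hx hy => rw [map_add, hx, hy, add_zero]
      | mul x y _ _ hx hy => rw [D.leibniz, hx, hy]; simp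
    funext j
    have halg := hB.isAlgebraic
    rw [Subtype.range_coe] at halg
    have := D.eq_zero_of_isAlgebraic _ hDS (halg.isAlgebraic (MvPolynomial.X j))
    simpa [D, MvPolynomial.mkDerivation_X] using this
  obtain ⟨y, hy⟩ : ∃ y : σ → ℝ, MvPolynomial.eval y J.det ≠ 0 := by
    by_contra! h
    exact hJ (MvPolynomial.funext fun y => by simpa using h y)
  refine ⟨y, ?_⟩
  have hy' : IsUnit (J.map (MvPolynomial.eval y)) := by
    rw [Matrix.isUnit_iff_isUnit_det, isUnit_iff_ne_zero]
    rwa [RingHom.map_det] at hy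
  have hrows := Matrix.linearIndependent_rows_iff_isUnit.mpr hy'
  have hinj : Function.Injective fun i => e ⟨F i, hFB ⟨i, rfl⟩⟩ := by
    intro a b hab
    exact AlgebraicIndependent.injective hF (congrArg Subtype.val (e.injective hab))
  have := hrows.comp _ hinj
  have hrow : (J.map (MvPolynomial.eval y)).row ∘ (fun i => e ⟨F i, hFB ⟨i, rfl⟩⟩) =
      fun i j => MvPolynomial.eval y (MvPolynomial.pderiv j (F i)) := by
    funext i j
    change MvPolynomial.eval y (MvPolynomial.pderiv j (e.symm (e ⟨F i, hFB ⟨i, rfl⟩⟩)).1) = _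
    rw [Equiv.symm_apply_apply]
  rwa [hrow] at this

theorem MvPolynomial.hasFDerivAt_eval {σ : Type*} [Fintype σ] (p : MvPolynomial σ ℝ) (y : σ → ℝ) :
    HasFDerivAt (fun z : σ → ℝ => MvPolynomial.eval z p)
      (∑ j, MvPolynomial.eval y (MvPolynomial.pderiv j p) •
        (ContinuousLinearMap.proj j : (σ → ℝ) →L[ℝ] ℝ)) y := by
  classical
  induction p using MvPolynomial.induction_on with
  | C a => simpa using hasFDerivAt_const a y
  | add p q hp hq =>
    simp only [map_add, add_smul, Finset.sum_add_distrib]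
    exact hp.add hq
  | mul_X p i hp =>
    simp only [map_mul, MvPolynomial.eval_X]
    refine (hp.mul (hasFDerivAt_apply i y)).congr_fderiv ?_
    ext v
    simp [Derivation.leibniz, MvPolynomial.pderiv_X, Pi.single_apply, add_mul,
      Finset.sum_add_distrib, Finset.mul_sum, mul_assoc, apply_ite (MvPolynomial.eval y)]

/-- A surjective real polynomial map has a surjective derivative at some point. -/
theorem MvPolynomial.exists_surjective_fderiv {ι σ : Type*} [Fintype ι] [Fintype σ]
    (F : ι → MvPolynomial σ ℝ)
    (hF : Function.Surjective fun (y : σ → ℝ) (i : ι) => MvPolynomial.eval y (F i)) :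
    ∃ y : σ → ℝ, Function.Surjective
      (fderiv ℝ (fun (z : σ → ℝ) (i : ι) => MvPolynomial.eval z (F i)) y) := by
  classical
  -- By surjectivity, a relation among the components vanishes on all of `ℝ^ι`, hence is the zero
  -- polynomial.
  have hind : AlgebraicIndependent ℝ F := by
    rw [algebraicIndependent_iff]
    intro p hp
    apply MvPolynomial.funext
    intro s
    obtain ⟨y, rfl⟩ := hF s
    have := congrArg (MvPolynomial.eval y) hp
    rw [map_zero] at this
    rw [map_zero, ← this, MvPolynomial.map_aeval]
    have hid : (MvPolynomial.eval y).comp (algebraMap ℝ (MvPolynomial σ ℝ)) = RingHom.id ℝ := by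
      ext x
      simp [MvPolynomial.algebraMap_eq]
    rw [hid]
    rfl
  obtain ⟨y, hy⟩ := hind.exists_linearIndependent_pderiv
  refine ⟨y, ?_⟩
  have hd := hasFDerivAt_pi.mpr fun i => MvPolynomial.hasFDerivAt_eval (F i) y
  rw [hd.fderiv]
  let M : Matrix ι σ ℝ := fun i j => MvPolynomial.eval y (MvPolynomial.pderiv j (F i))
  have hM : Function.Surjective M.mulVec := by
    have hrank : M.rank = Fintype.card ι := LinearIndependent.rank_matrix hy
    rw [← Matrix.coe_mulVecLin, ← LinearMap.range_eq_top]
    apply Submodule.eq_top_of_finrank_eq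
    rw [Module.finrank_fintype_fun_eq_card]
    exact hrank
  intro s
  obtain ⟨v, hv⟩ := hM s
  refine ⟨v, ?_⟩
  rw [← hv]
  funext i
  simp [M, Matrix.mulVec, dotProduct]

/-! ### Rank of the derivative of the moment map. -/

theorem hasFullRankAt_iff_surjective {ι : Type*} [Fintype ι] {n : ℕ} {f : ι → (Fin n → ℝ) → ℝ}
    {k : ℕ} {P : (Fin k → ℝ) × (Fin k → Fin n → ℝ)} :
    HasFullRankAt f k P ↔ Function.Surjective (fderiv ℝ (momentMap f k) P) := by
  rw [HasFullRankAt, ← Module.finrank_fintype_fun_eq_card ℝ]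
  constructor
  · intro h
    exact LinearMap.range_eq_top.mp (Submodule.eq_top_of_finrank_eq h)
  · intro h
    rw [LinearMap.range_eq_top.mpr h, finrank_top]

theorem analyticAt_momentMap {ι : Type*} [Fintype ι] {n : ℕ} {f : ι → (Fin n → ℝ) → ℝ}
    (hf : ∀ j x, AnalyticAt ℝ (f j) x) (k : ℕ) (P : (Fin k → ℝ) × (Fin k → Fin n → ℝ)) :
    AnalyticAt ℝ (momentMap f k) P := by
  refine AnalyticAt.pi fun j => ?_
  unfold momentMap
  refine Finset.analyticAt_fun_sum _ fun i _ => ?_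
  have h1 : AnalyticAt ℝ (fun Q : (Fin k → ℝ) × (Fin k → Fin n → ℝ) => Q.1 i) P :=
    ((ContinuousLinearMap.proj (R := ℝ) (φ := fun _ : Fin k => ℝ) i).comp
      (ContinuousLinearMap.fst ℝ (Fin k → ℝ) (Fin k → Fin n → ℝ))).analyticAt P
  have h2 : AnalyticAt ℝ (fun Q : (Fin k → ℝ) × (Fin k → Fin n → ℝ) => Q.2 i) P :=
    ((ContinuousLinearMap.proj (R := ℝ) (φ := fun _ : Fin k => Fin n → ℝ) i).comp
      (ContinuousLinearMap.snd ℝ (Fin k → ℝ) (Fin k → Fin n → ℝ))).analyticAt P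
  exact h1.mul ((hf j (P.2 i)).comp_of_eq h2 rfl)

theorem fderiv_momentMap_apply {ι : Type*} [Fintype ι] {n : ℕ} {f : ι → (Fin n → ℝ) → ℝ}
    (hf : ∀ j x, AnalyticAt ℝ (f j) x) (k : ℕ) (P Q : (Fin k → ℝ) × (Fin k → Fin n → ℝ)) (j : ι) :
    fderiv ℝ (momentMap f k) P Q j =
      ∑ i, (P.1 i * fderiv ℝ (f j) (P.2 i) (Q.2 i) + f j (P.2 i) * Q.1 i) := by
  let p1 (i : Fin k) : (Fin k → ℝ) × (Fin k → Fin n → ℝ) →L[ℝ] ℝ :=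
    (ContinuousLinearMap.proj (R := ℝ) (φ := fun _ : Fin k => ℝ) i).comp
      (ContinuousLinearMap.fst ℝ (Fin k → ℝ) (Fin k → Fin n → ℝ))
  let p2 (i : Fin k) : (Fin k → ℝ) × (Fin k → Fin n → ℝ) →L[ℝ] (Fin n → ℝ) :=
    (ContinuousLinearMap.proj (R := ℝ) (φ := fun _ : Fin k => Fin n → ℝ) i).comp
      (ContinuousLinearMap.snd ℝ (Fin k → ℝ) (Fin k → Fin n → ℝ))
  have hd : HasFDerivAt (momentMap f k) (ContinuousLinearMap.pi fun j => ∑ i,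
      (P.1 i • (fderiv ℝ (f j) (P.2 i)).comp (p2 i) + f j (P.2 i) • p1 i)) P := by
    refine hasFDerivAt_pi.mpr fun j => ?_
    refine HasFDerivAt.fun_sum fun i _ => ?_
    have h2 : HasFDerivAt (fun R : (Fin k → ℝ) × (Fin k → Fin n → ℝ) => f j (R.2 i))
        ((fderiv ℝ (f j) (P.2 i)).comp (p2 i)) P :=
      ((hf j (P.2 i)).differentiableAt.hasFDerivAt).comp P (p2 i).hasFDerivAt
    exact (p1 i).hasFDerivAt.mul h2
  rw [hd.fderiv]
  simp [p1, p2]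

/-- The rank at `(C, X)` is at most the rank at `((1, …, 1), X)`. -/
theorem HasFullRankAt.one {ι : Type*} [Fintype ι] {n : ℕ} {f : ι → (Fin n → ℝ) → ℝ}
    (hf : ∀ j x, AnalyticAt ℝ (f j) x) {k : ℕ} {P : (Fin k → ℝ) × (Fin k → Fin n → ℝ)}
    (hP : HasFullRankAt f k P) : HasFullRankAt f k (fun _ => 1, P.2) := by
  rw [hasFullRankAt_iff_surjective] at *
  intro s
  obtain ⟨Q, rfl⟩ := hP s
  -- The coefficient `P.1 i` is absorbed into the tangent vector at the `i`-th point.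
  refine ⟨(Q.1, fun i => P.1 i • Q.2 i), ?_⟩
  funext j
  simp [fderiv_momentMap_apply hf]

/-- Fix a right inverse `R` of the derivative at `l₀`. The determinant of the derivative at `l`
composed with `R` is analytic in `l`, equals `1` at `l₀`, and forces surjectivity wherever it is
nonzero. -/
theorem HasFullRankAt.exists_analytic {ι : Type*} [Fintype ι] {n : ℕ} {f : ι → (Fin n → ℝ) → ℝ}
    (hf : ∀ j x, AnalyticAt ℝ (f j) x) {k : ℕ} {l₀ : Fin k → Fin n → ℝ}
    (h₀ : HasFullRankAt f k (fun _ => 1, l₀)) :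
    ∃ g : (Fin k → Fin n → ℝ) → ℝ, AnalyticOnNhd ℝ g Set.univ ∧ g l₀ ≠ 0 ∧
      ∀ l, g l ≠ 0 → HasFullRankAt f k (fun _ => 1, l) := by
  classical
  rw [hasFullRankAt_iff_surjective] at h₀
  obtain ⟨R, hR⟩ := LinearMap.exists_rightInverse_of_surjective
    (fderiv ℝ (momentMap f k) (fun _ => 1, l₀)).toLinearMap (LinearMap.range_eq_top.mpr h₀)
  let T (l : Fin k → Fin n → ℝ) : (ι → ℝ) →ₗ[ℝ] (ι → ℝ) :=
    (fderiv ℝ (momentMap f k) (fun _ => 1, l)).toLinearMap ∘ₗ R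
  refine ⟨fun l => (LinearMap.toMatrix' (T l)).det, ?_, ?_, ?_⟩
  · intro l _
    simp only [Matrix.det_apply']
    refine Finset.analyticAt_fun_sum _ fun τ _ => ?_
    have hprod : AnalyticAt ℝ (fun l => ∏ i, LinearMap.toMatrix' (T l) (τ i) i) l := by
      refine Finset.analyticAt_fun_prod _ fun i _ => ?_
      have h1 : AnalyticAt ℝ (fun l : Fin k → Fin n → ℝ =>
          ((fun _ => 1, l) : (Fin k → ℝ) × (Fin k → Fin n → ℝ))) l :=
        analyticAt_const.prod analyticAt_id
      have h2 : AnalyticAt ℝ (fun l : Fin k → Fin n → ℝ =>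
          fderiv ℝ (momentMap f k) (fun _ => 1, l)) l :=
        (analyticAt_momentMap hf k _).fderiv.comp_of_eq h1 rfl
      let ev : ((Fin k → ℝ) × (Fin k → Fin n → ℝ) →L[ℝ] (ι → ℝ)) →L[ℝ] ℝ :=
        (ContinuousLinearMap.proj (R := ℝ) (φ := fun _ : ι => ℝ) (τ i)).comp
          (ContinuousLinearMap.apply ℝ (ι → ℝ) (R (Pi.single i 1)))
      have h3 := (ev.analyticAt (fderiv ℝ (momentMap f k) (fun _ => 1, l))).comp_of_eq h2 rfl
      refine h3.congr (Filter.Eventually.of_forall fun l' => ?_)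
      simp [ev, LinearMap.toMatrix'_apply, T]
    exact analyticAt_const.mul hprod
  · have : T l₀ = LinearMap.id := hR
    simp [this]
  · intro l hl
    replace hl : LinearMap.det (T l) ≠ 0 := by simpa only [LinearMap.det_toMatrix'] using hl
    rw [hasFullRankAt_iff_surjective]
    have hT : Function.Surjective (T l) := (LinearMap.equivOfDetNeZero (T l) hl).surjective
    intro s
    obtain ⟨v, hv⟩ := hT s
    exact ⟨R v, hv⟩

theorem isOpen_hasFullRankAt_one {ι : Type*} [Fintype ι] {n : ℕ} {f : ι → (Fin n → ℝ) → ℝ}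
    (hf : ∀ j x, AnalyticAt ℝ (f j) x) (k : ℕ) :
    IsOpen {l : Fin k → Fin n → ℝ | HasFullRankAt f k (fun _ => 1, l)} := by
  rw [isOpen_iff_mem_nhds]
  intro l₀ h₀
  obtain ⟨g, hg, hg0, himp⟩ := HasFullRankAt.exists_analytic hf h₀
  filter_upwards [(hg l₀ trivial).continuousAt.eventually_ne hg0] with l hl
  exact himp l hl

/-- If the analytic determinant vanished on a nonempty open set, it would vanish identically,
contradicting its value at `l₀`. -/
theorem dense_hasFullRankAt_one {ι : Type*} [Fintype ι] {n : ℕ} {f : ι → (Fin n → ℝ) → ℝ}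
    (hf : ∀ j x, AnalyticAt ℝ (f j) x) {k : ℕ} {l₀ : Fin k → Fin n → ℝ}
    (h₀ : HasFullRankAt f k (fun _ => 1, l₀)) :
    Dense {l : Fin k → Fin n → ℝ | HasFullRankAt f k (fun _ => 1, l)} := by
  obtain ⟨g, hg, hg0, himp⟩ := HasFullRankAt.exists_analytic hf h₀
  refine Dense.mono (s₁ := {l | g l ≠ 0}) himp ?_
  rw [← Set.compl_ofPred, ← interior_eq_empty_iff_dense_compl, Set.eq_empty_iff_forall_notMem]
  intro l hl
  have hz : g =ᶠ[nhds l] 0 := by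
    filter_upwards [mem_interior_iff_mem_nhds.mp hl] with x hx using hx
  exact hg0 (hg.eqOn_zero_of_preconnected_of_eventuallyEq_zero isPreconnected_univ
    (Set.mem_univ l) hz (Set.mem_univ l₀))

/-- At a point of full rank, nearby coefficients and points reach the moment sequence displaced by
a small multiple of any prescribed vector. -/
theorem HasFullRankAt.exists_momentMap_eq_sub {ι : Type*} [Fintype ι] {n : ℕ}
    {f : ι → (Fin n → ℝ) → ℝ} (hf : ∀ j x, AnalyticAt ℝ (f j) x) {k : ℕ}
    {P : (Fin k → ℝ) × (Fin k → Fin n → ℝ)} (hP : HasFullRankAt f k P)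
    {U : Set ((Fin k → ℝ) × (Fin k → Fin n → ℝ))} (hU : U ∈ nhds P) (s : ι → ℝ) :
    ∃ t : ℝ, t ≠ 0 ∧ ∃ Q ∈ U, momentMap f k Q = momentMap f k P - t • s := by
  rw [hasFullRankAt_iff_surjective] at hP
  have hstrict := (analyticAt_momentMap hf k P).hasStrictFDerivAt
  have hmap := hstrict.map_nhds_eq_of_surj (LinearMap.range_eq_top.mpr hP)
  have himg : momentMap f k '' U ∈ nhds (momentMap f k P) := by
    rw [← hmap]
    exact Filter.image_mem_map hU
  have hcont : Filter.Tendsto (fun t : ℝ => momentMap f k P - t • s) (nhds 0)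
      (nhds (momentMap f k P)) := by
    have : Continuous fun t : ℝ => momentMap f k P - t • s := by fun_prop
    simpa using this.tendsto 0
  -- The punctured neighbourhood of `0` secures `t ≠ 0`.
  have hev : ∀ᶠ t in nhdsWithin (0 : ℝ) {0}ᶜ, momentMap f k P - t • s ∈ momentMap f k '' U :=
    (hcont.eventually himg).filter_mono nhdsWithin_le_nhds
  obtain ⟨t, ⟨Q, hQ, hQt⟩, ht⟩ := (hev.and self_mem_nhdsWithin).exists
  exact ⟨t, ht, Q, hQ, hQt⟩

/-! ### Correspondence between moment sequences and forms. -/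

theorem analyticAt_monomialFun {n e : ℕ} (α : Exponent n e) (x : Fin n → ℝ) :
    AnalyticAt ℝ (monomialFun n e α) x := by
  unfold monomialFun
  refine Finset.analyticAt_fun_prod _ fun i _ => ?_
  exact ((ContinuousLinearMap.proj (R := ℝ) (φ := fun _ : Fin n => ℝ) i).analyticAt x).pow _

/-- The form of degree `e` whose coefficient at `x^α` is the multinomial coefficient of `α` times
`s_α`. -/
noncomputable def formOfMoments (n e : ℕ) : (Exponent n e → ℝ) →ₗ[ℝ] MvPolynomial (Fin n) ℝ :=
  ∑ α : Exponent n e, (MvPolynomial.monomial (Finsupp.equivFunOnFinite.symm α.1)) ∘ₗ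
    ((Nat.multinomial Finset.univ α.1 : ℝ) • LinearMap.proj α)

theorem formOfMoments_apply (n e : ℕ) (s : Exponent n e → ℝ) :
    formOfMoments n e s = ∑ α : Exponent n e,
      MvPolynomial.monomial (Finsupp.equivFunOnFinite.symm α.1)
        ((Nat.multinomial Finset.univ α.1 : ℝ) * s α) := by
  simp [formOfMoments]

theorem coeff_formOfMoments (n e : ℕ) (s : Exponent n e → ℝ) (β : Exponent n e) :
    MvPolynomial.coeff (Finsupp.equivFunOnFinite.symm β.1) (formOfMoments n e s) =
      (Nat.multinomial Finset.univ β.1 : ℝ) * s β := by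
  classical
  rw [formOfMoments_apply, MvPolynomial.coeff_sum, Finset.sum_eq_single β]
  · simp
  · intro α _ hα
    rw [MvPolynomial.coeff_monomial, if_neg]
    intro h
    exact hα (Subtype.ext (Finsupp.equivFunOnFinite.symm.injective h))
  · simp

theorem multinomial_ne_zero {n : ℕ} (α : Fin n → ℕ) :
    (Nat.multinomial Finset.univ α : ℝ) ≠ 0 := by
  have := Nat.multinomial_pos (Finset.univ : Finset (Fin n)) α
  positivity

theorem formOfMoments_injective (n e : ℕ) : Function.Injective (formOfMoments n e) := by
  intro s t h
  funext β
  have := congrArg (MvPolynomial.coeff (Finsupp.equivFunOnFinite.symm β.1)) h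
  rw [coeff_formOfMoments, coeff_formOfMoments] at this
  exact mul_left_cancel₀ (multinomial_ne_zero _) this

theorem formOfMoments_mem (n e : ℕ) (s : Exponent n e → ℝ) :
    formOfMoments n e s ∈ MvPolynomial.homogeneousSubmodule (Fin n) ℝ e := by
  rw [formOfMoments_apply]
  refine Submodule.sum_mem _ fun α _ => ?_
  rw [MvPolynomial.mem_homogeneousSubmodule]
  refine MvPolynomial.isHomogeneous_monomial _ ?_
  rw [Finsupp.degree_eq_sum]
  exact (mem_exponent_iff n e α.1).mp α.2

theorem exists_formOfMoments_eq {n e : ℕ} {p : MvPolynomial (Fin n) ℝ}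
    (hp : p ∈ MvPolynomial.homogeneousSubmodule (Fin n) ℝ e) :
    ∃ s, formOfMoments n e s = p := by
  let s : Exponent n e → ℝ := fun α =>
    MvPolynomial.coeff (Finsupp.equivFunOnFinite.symm α.1) p / Nat.multinomial Finset.univ α.1
  refine ⟨s, ?_⟩
  have hs := formOfMoments_mem n e s
  rw [MvPolynomial.mem_homogeneousSubmodule] at hs hp
  ext m
  by_cases hm : m.degree = e
  · have hm' : (m : Fin n → ℕ) ∈ Finset.piAntidiag (Finset.univ : Finset (Fin n)) e := by
      rwa [mem_exponent_iff, ← Finsupp.degree_eq_sum]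
    have := coeff_formOfMoments n e s ⟨m, hm'⟩
    have hmm : Finsupp.equivFunOnFinite.symm (m : Fin n → ℕ) = m :=
      Finsupp.equivFunOnFinite.symm_apply_apply m
    simp only [hmm, s] at this
    rw [this, mul_div_cancel₀ _ (multinomial_ne_zero _)]
  · rw [hs.coeff_eq_zero hm, hp.coeff_eq_zero hm]

theorem eval_formOfMoments (n e : ℕ) (s : Exponent n e → ℝ) (x : Fin n → ℝ) :
    MvPolynomial.eval x (formOfMoments n e s) = ∑ α : Exponent n e,
      (Nat.multinomial Finset.univ α.1 : ℝ) * s α * monomialFun n e α x := by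
  rw [formOfMoments_apply, map_sum]
  refine Finset.sum_congr rfl fun α _ => ?_
  rw [MvPolynomial.eval_monomial, Finsupp.prod_fintype _ _ fun _ => pow_zero _]
  rfl

theorem eval_linForm {n : ℕ} (v x : Fin n → ℝ) :
    MvPolynomial.eval x (linForm v) = ∑ j, v j * x j := by
  simp [linForm]

theorem formOfMoments_monomialFun (n e : ℕ) (v : Fin n → ℝ) :
    formOfMoments n e (fun α => monomialFun n e α v) = linForm v ^ e := by
  apply MvPolynomial.funext
  intro x
  rw [eval_formOfMoments, map_pow, eval_linForm, Finset.sum_pow_eq_sum_piAntidiag]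
  refine Eq.trans (Finset.sum_congr rfl fun α _ => ?_) (Finset.sum_coe_sort _ _)
  simp only [monomialFun, mul_pow, Finset.prod_mul_distrib]
  ring

theorem formOfMoments_momentMap (n e k : ℕ) (P : (Fin k → ℝ) × (Fin k → Fin n → ℝ)) :
    formOfMoments n e (momentMap (monomialFun n e) k P) =
      ∑ i, MvPolynomial.C (P.1 i) * linForm (P.2 i) ^ e := by
  have : momentMap (monomialFun n e) k P = ∑ i, P.1 i • fun α => monomialFun n e α (P.2 i) := by
    funext α
    simp [momentMap]
  rw [this, map_sum]
  simp only [map_smul, formOfMoments_monomialFun, MvPolynomial.smul_eq_C_mul]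

theorem mem_waringBounds_iff {n e K : ℕ} :
    K ∈ waringBounds n e ↔
      ∀ s : Exponent n e → ℝ, ∃ k ≤ K, ∃ P, momentMap (monomialFun n e) k P = s := by
  constructor
  · intro h s
    obtain ⟨k, hk, c, l, hs⟩ := h _ (formOfMoments_mem n e s)
    refine ⟨k, hk, (c, l), formOfMoments_injective n e ?_⟩
    rw [formOfMoments_momentMap, hs]
  · intro h p hp
    obtain ⟨s, rfl⟩ := exists_formOfMoments_eq hp
    obtain ⟨k, hk, P, rfl⟩ := h s
    exact ⟨k, hk, P.1, P.2, formOfMoments_momentMap n e k P⟩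

/-- A functional that vanishes on all moment vectors is, after division by the multinomial
coefficients, a form that vanishes at every point, hence zero. -/
theorem span_range_monomialFun (n e : ℕ) :
    Submodule.span ℝ (Set.range fun x : Fin n → ℝ => fun α => monomialFun n e α x) = ⊤ := by
  classical
  by_contra h
  obtain ⟨φ, hφ, hle⟩ := Submodule.exists_le_ker_of_lt_top _ (lt_top_iff_ne_top.mpr h)
  apply hφ
  let a : Exponent n e → ℝ := fun α =>
    φ (fun β => if α = β then 1 else 0) / Nat.multinomial Finset.univ α.1
  have ha : formOfMoments n e a = formOfMoments n e 0 := by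
    apply MvPolynomial.funext
    intro x
    rw [eval_formOfMoments, map_zero, map_zero]
    have hx : φ (fun α => monomialFun n e α x) = 0 := hle (Submodule.subset_span ⟨x, rfl⟩)
    rw [LinearMap.pi_apply_eq_sum_univ] at hx
    rw [← hx]
    refine Finset.sum_congr rfl fun α _ => ?_
    simp only [a]
    rw [mul_div_cancel₀ _ (multinomial_ne_zero _), smul_eq_mul, mul_comm]
  have ha' := formOfMoments_injective n e ha
  refine LinearMap.ext fun v => ?_
  rw [LinearMap.pi_apply_eq_sum_univ, LinearMap.zero_apply]
  refine Finset.sum_eq_zero fun α _ => ?_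
  have := congrFun ha' α
  simp only [a, Pi.zero_apply, div_eq_zero_iff, multinomial_ne_zero, or_false] at this
  rw [this, smul_zero]

/-! ### Passage to projective space. -/

theorem monomialFun_smul {n e : ℕ} (α : Exponent n e) (t : ℝ) (x : Fin n → ℝ) :
    monomialFun n e α (t • x) = t ^ e * monomialFun n e α x := by
  have h := (mem_exponent_iff n e α.1).mp α.2
  simp only [monomialFun, Pi.smul_apply, smul_eq_mul, mul_pow, Finset.prod_mul_distrib,
    Finset.prod_pow_eq_pow_sum, h]

theorem HalfSphere.exists_smul_eq {n : ℕ} {l : Fin n → ℝ} (hl : l ≠ 0) :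
    ∃ (t : ℝ) (y : HalfSphere n), l = t • y.1 := by
  obtain ⟨i₀, hi₀⟩ := Function.ne_iff.mp hl
  obtain ⟨i, hi, hmin⟩ := WellFounded.has_min (wellFounded_lt (α := Fin n)) {i | l i ≠ 0} ⟨i₀, hi₀⟩
  have hmin' : ∀ j < i, l j = 0 := fun j hj => by
    by_contra h
    exact hmin j h hj
  have hi : l i ≠ 0 := hi
  have hpos : 0 < ∑ j, l j ^ 2 :=
    Finset.sum_pos' (fun j _ => sq_nonneg _) ⟨i, Finset.mem_univ i, by positivity⟩
  -- `t` is the Euclidean norm of `l` with the sign of its first nonzero coordinate.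
  obtain ⟨t, ht, hti⟩ : ∃ t : ℝ, t ^ 2 = ∑ j, l j ^ 2 ∧ 0 < t⁻¹ * l i := by
    rcases lt_or_gt_of_ne hi with h | h
    · refine ⟨-√(∑ j, l j ^ 2), by rw [neg_sq, Real.sq_sqrt hpos.le], ?_⟩
      exact mul_pos_of_neg_of_neg (inv_lt_zero.mpr (neg_lt_zero.mpr (Real.sqrt_pos.mpr hpos))) h
    · exact ⟨√(∑ j, l j ^ 2), Real.sq_sqrt hpos.le,
        mul_pos (inv_pos.mpr (Real.sqrt_pos.mpr hpos)) h⟩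
  have ht0 : t ≠ 0 := by
    rintro rfl
    simp at hti
  refine ⟨t, ⟨t⁻¹ • l, ?_, i, hti, fun j hj => by simp [hmin' j hj]⟩, by simp [ht0]⟩
  simp only [Pi.smul_apply, smul_eq_mul, mul_pow, ← Finset.mul_sum, ← ht]
  field_simp

theorem monomialFun_zero {n e : ℕ} (he : e ≠ 0) (α : Exponent n e) : monomialFun n e α 0 = 0 := by
  simpa [he] using monomialFun_smul α 0 0

/-- Finitely supported functions make merging of equal atoms automatic under addition. The point `0`
has no projective image, but contributes nothing because `e ≠ 0`. -/
theorem exists_finsupp_halfSphere {n e : ℕ} (he : e ≠ 0) (c : ℝ) (l : Fin n → ℝ) :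
    ∃ g : HalfSphere n →₀ ℝ, g.support.card ≤ 1 ∧
      ∀ α, (g.sum fun y a => a * projMonomialFun n e α y) = c * monomialFun n e α l := by
  by_cases hl : l = 0
  · exact ⟨0, by simp, fun α => by simp [hl, monomialFun_zero he]⟩
  · obtain ⟨t, y, rfl⟩ := HalfSphere.exists_smul_eq hl
    refine ⟨Finsupp.single y (c * t ^ e), (Finset.card_le_card Finsupp.support_single_subset).trans (by simp), fun α => ?_⟩
    rw [Finsupp.sum_single_index (by simp), monomialFun_smul, projMonomialFun, mul_assoc]

theorem hasSignedAtomicMeasure_finsupp {ι 𝓧 : Type*} (f : ι → 𝓧 → ℝ) (g : 𝓧 →₀ ℝ) :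
    HasSignedAtomicMeasure f g.support.card fun j => g.sum fun y a => a * f j y := by
  let e := g.support.equivFin.symm
  refine ⟨fun i => g (e i), fun i => e i, fun i => Finsupp.mem_support_iff.mp (e i).2,
    Subtype.val_injective.comp e.injective, ?_⟩
  funext j
  rw [Finsupp.sum, ← Finset.sum_coe_sort]
  exact Equiv.sum_comp e fun y => g y * f j y

/-- Every representation by points of `ℝⁿ` is turned into one by pairwise different points of the
half sphere: scale the points, and merge those that become equal. -/
theorem exists_hasSignedAtomicMeasure_momentMap {n e : ℕ} (he : e ≠ 0) (k : ℕ)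
    (P : (Fin k → ℝ) × (Fin k → Fin n → ℝ)) :
    ∃ k' ≤ k, HasSignedAtomicMeasure (projMonomialFun n e) k' (momentMap (monomialFun n e) k P) := by
  classical
  choose g hcard hsum using fun i => exists_finsupp_halfSphere he (P.1 i) (P.2 i)
  refine ⟨(∑ i, g i).support.card, ?_, ?_⟩
  · calc (∑ i, g i).support.card ≤ (Finset.univ.biUnion fun i => (g i).support).card :=
          Finset.card_le_card Finsupp.support_finsetSum
      _ ≤ ∑ i, (g i).support.card := Finset.card_biUnion_le
      _ ≤ ∑ _i : Fin k, 1 := Finset.sum_le_sum fun i _ => hcard i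
      _ = k := by simp
  · convert hasSignedAtomicMeasure_finsupp (projMonomialFun n e) (∑ i, g i) using 1
    funext α
    rw [← Finsupp.sum_finsetSum_index (by simp) (by intros; ring)]
    simp only [hsum]
    rfl

theorem signedCaratheodoryBounds_projMonomialFun {n e : ℕ} (he : e ≠ 0) :
    signedCaratheodoryBounds (projMonomialFun n e) = waringBounds n e := by
  ext K
  rw [mem_waringBounds_iff]
  constructor
  · intro h s
    obtain ⟨k, hk, c, x, -, -, hs⟩ := h s
    exact ⟨k, hk, (c, fun i => (x i).1), hs⟩
  · intro h s
    obtain ⟨k, hk, P, rfl⟩ := h s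
    obtain ⟨k', hk', hP⟩ := exists_hasSignedAtomicMeasure_momentMap he k P
    exact ⟨k', hk'.trans hk, hP⟩

/-! ### Comparison of the Waring rank with the full rank number. -/

theorem exponent_nonempty {n : ℕ} (hn : 1 ≤ n) (e : ℕ) : Nonempty (Exponent n e) :=
  ⟨⟨Pi.single ⟨0, hn⟩ e, by rw [mem_exponent_iff]; simp⟩⟩

/-- Finitely many moment vectors span, and with these atoms the coefficient directions alone make
the derivative surjective. -/
theorem fullRankNumbers_nonempty {ι : Type*} [Fintype ι] [Nonempty ι] {n : ℕ}
    {f : ι → (Fin n → ℝ) → ℝ} (hf : ∀ j x, AnalyticAt ℝ (f j) x)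
    (hspan : Submodule.span ℝ (Set.range fun x j => f j x) = ⊤) : (fullRankNumbers f).Nonempty := by
  obtain ⟨t, ht, htop⟩ := (Submodule.fg_span_iff_fg_span_finset_subset _).mp
    (hspan ▸ Module.Finite.fg_top : (Submodule.span ℝ (Set.range fun x j => f j x)).FG)
  rw [hspan] at htop
  have hpre : ∀ v : t, ∃ x : Fin n → ℝ, (fun j => f j x) = v.1 := fun v => ht v.2
  choose X hX using hpre
  let e := t.equivFin.symm
  refine ⟨t.card, ?_, (fun _ => 1, fun i => X (e i)), fun _ => zero_le_one, ?_⟩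
  · rw [Nat.one_le_iff_ne_zero]
    intro h0
    rw [Finset.card_eq_zero.mp h0, Finset.coe_empty, Submodule.span_empty] at htop
    exact top_ne_bot htop
  · rw [hasFullRankAt_iff_surjective]
    intro s
    have hs : s ∈ Submodule.span ℝ (t : Set (ι → ℝ)) := htop ▸ Submodule.mem_top
    obtain ⟨g, -, rfl⟩ := Submodule.mem_span_finset.mp hs
    refine ⟨(fun i => g (e i), 0), ?_⟩
    funext j
    rw [fderiv_momentMap_apply hf, Finset.sum_apply, ← Finset.sum_coe_sort t]
    refine Eq.trans (Finset.sum_congr rfl fun i _ => ?_)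
      (Equiv.sum_comp e fun v => (g v.1 • v.1) j)
    have := congrFun (hX (e i)) j
    simp [this, mul_comm]

/-- In the `k + kn` coordinates of coefficients and points the moment map is polynomial, so the
Jacobian criterion applies. -/
theorem exists_hasFullRankAt_of_surjective {n e k : ℕ}
    (h : Function.Surjective (momentMap (monomialFun n e) k)) :
    ∃ P, HasFullRankAt (monomialFun n e) k P := by
  let F : Exponent n e → MvPolynomial (Fin k ⊕ (Fin k × Fin n)) ℝ := fun α =>
    ∑ i, MvPolynomial.X (Sum.inl i) * ∏ j, MvPolynomial.X (Sum.inr (i, j)) ^ α.1 j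
  let L : (Fin k ⊕ (Fin k × Fin n) → ℝ) →L[ℝ] (Fin k → ℝ) × (Fin k → Fin n → ℝ) :=
    (ContinuousLinearMap.pi fun i => ContinuousLinearMap.proj (Sum.inl i)).prod
      (ContinuousLinearMap.pi fun i => ContinuousLinearMap.pi fun j =>
        ContinuousLinearMap.proj (Sum.inr (i, j)))
  have hFL : (fun (y : Fin k ⊕ (Fin k × Fin n) → ℝ) α => MvPolynomial.eval y (F α)) =
      momentMap (monomialFun n e) k ∘ L := by
    funext y α
    simp [F, L, momentMap, monomialFun]
  have hL : Function.Surjective L := fun P => ⟨Sum.elim P.1 fun q => P.2 q.1 q.2, rfl⟩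
  obtain ⟨y, hy⟩ := MvPolynomial.exists_surjective_fderiv F (hFL ▸ h.comp hL)
  refine ⟨L y, hasFullRankAt_iff_surjective.mpr ?_⟩
  rw [hFL, fderiv_comp y (analyticAt_momentMap analyticAt_monomialFun k _).differentiableAt
    L.differentiableAt] at hy
  exact Function.Surjective.of_comp hy

theorem momentMap_append {ι 𝓧 : Type*} (f : ι → 𝓧 → ℝ) {k r : ℕ} (c : Fin k → ℝ) (c' : Fin r → ℝ)
    (x : Fin k → 𝓧) (x' : Fin r → 𝓧) :
    momentMap f (k + r) (Fin.append c c', Fin.append x x') =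
      momentMap f k (c, x) + momentMap f r (c', x') := by
  funext j
  simp [momentMap, Fin.sum_univ_add]

theorem momentMap_surjective_of_mem_waringBounds {n e K : ℕ} (h : K ∈ waringBounds n e) :
    Function.Surjective (momentMap (monomialFun n e) K) := by
  intro s
  obtain ⟨k, hk, P, rfl⟩ := mem_waringBounds_iff.mp h s
  obtain ⟨r, rfl⟩ := Nat.exists_eq_add_of_le hk
  -- Missing atoms are filled in with coefficient `0`.
  refine ⟨(Fin.append P.1 0, Fin.append P.2 0), ?_⟩
  rw [momentMap_append, add_eq_left]
  funext α
  simp [momentMap]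

theorem mem_fullRankNumbers_of_mem_waringBounds {n e K : ℕ} (hn : 1 ≤ n)
    (h : K ∈ waringBounds n e) : K ∈ fullRankNumbers (monomialFun n e) := by
  have hs := momentMap_surjective_of_mem_waringBounds h
  constructor
  · rw [Nat.one_le_iff_ne_zero]
    rintro rfl
    obtain ⟨α⟩ := exponent_nonempty hn e
    obtain ⟨P, hP⟩ := hs fun _ => 1
    simpa [momentMap] using congrFun hP α
  · obtain ⟨P, hP⟩ := exists_hasFullRankAt_of_surjective hs
    exact ⟨_, fun _ => zero_le_one, hP.one analyticAt_monomialFun⟩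

theorem HasFullRankAt.isWaringBasePoint {n e N : ℕ} {l : Fin N → Fin n → ℝ}
    (h : HasFullRankAt (monomialFun n e) N (fun _ => 1, l)) : IsWaringBasePoint e N l := by
  intro ε hε p hp
  obtain ⟨s, rfl⟩ := exists_formOfMoments_eq hp
  have hU : {Q : (Fin N → ℝ) × (Fin N → Fin n → ℝ) |
      Real.sqrt (∑ i, ∑ j, (l i j - Q.2 i j) ^ 2) < ε ∧ ∀ i, |1 - Q.1 i| < ε} ∈
      nhds ((fun _ => 1, l) : (Fin N → ℝ) × (Fin N → Fin n → ℝ)) := by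
    refine IsOpen.mem_nhds ?_ ⟨by simpa using hε, fun _ => by simpa using hε⟩
    refine IsOpen.and (isOpen_lt (by fun_prop) continuous_const) ?_
    simp only [Set.ofPred_forall]
    exact isOpen_iInter_of_finite fun i => isOpen_lt (by fun_prop) continuous_const
  obtain ⟨t, ht, Q, ⟨hQl, hQc⟩, hQ⟩ := h.exists_momentMap_eq_sub analyticAt_monomialFun hU s
  refine ⟨Q.2, Q.1, t⁻¹, hQl, hQc, ?_⟩
  have hs : s = t⁻¹ • (momentMap (monomialFun n e) N (fun _ => 1, l) -
      momentMap (monomialFun n e) N Q) := by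
    rw [hQ, sub_sub_cancel, smul_smul, inv_mul_cancel₀ ht, one_smul]
  conv_lhs => rw [hs]
  rw [map_smul, map_sub, formOfMoments_momentMap, formOfMoments_momentMap,
    MvPolynomial.smul_eq_C_mul, Finset.sum_sub_distrib]
  simp

theorem IsWaringBasePoint.two_mul_mem_waringBounds {n e N : ℕ} {l : Fin N → Fin n → ℝ}
    (h : IsWaringBasePoint e N l) : 2 * N ∈ waringBounds n e := by
  intro p hp
  -- Closeness plays no role here; any `ε` would do.
  obtain ⟨l', c, a, -, -, rfl⟩ := h 1 one_pos p hp
  refine ⟨N + N, (two_mul N).ge, Fin.append (fun _ => a) fun i => -(a * c i), Fin.append l l', ?_⟩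
  rw [Fin.sum_univ_add]
  simp only [Fin.append_left, Fin.append_right, map_neg, map_mul, neg_mul, mul_assoc,
    Finset.sum_neg_distrib, ← Finset.mul_sum, Finset.sum_sub_distrib]
  rw [mul_sub, sub_eq_add_neg]

theorem isLeast_sInf {S : Set ℕ} (hS : S.Nonempty) : IsLeast S (sInf S) :=
  ⟨Nat.sInf_mem hS, fun _ h => Nat.sInf_le h⟩

theorem mainTheorem8 (n d : ℕ) (hn : 1 ≤ n) (hd : 1 ≤ d) :
    -- the minima that define the three numbers are attained
    IsLeast (waringBounds n (2 * d)) (realWaringRank n (2 * d)) ∧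
    IsLeast (signedCaratheodoryBounds (projMonomialFun n (2 * d)))
      (signedCaratheodoryNumber (projMonomialFun n (2 * d))) ∧
    IsLeast (fullRankNumbers (monomialFun n (2 * d))) (fullRankNumber (monomialFun n (2 * d))) ∧
    -- (i)
    realWaringRank n (2 * d) = signedCaratheodoryNumber (projMonomialFun n (2 * d)) ∧
    -- (ii)
    fullRankNumber (monomialFun n (2 * d)) ≤ realWaringRank n (2 * d) ∧
    realWaringRank n (2 * d) ≤ 2 * fullRankNumber (monomialFun n (2 * d)) ∧
    -- (iii)
    (∃ l : Fin (fullRankNumber (monomialFun n (2 * d))) → Fin n → ℝ,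
      IsWaringBasePoint (2 * d) (fullRankNumber (monomialFun n (2 * d))) l) ∧
    -- (iv): the base points at which the derivative has full rank are as in (iii),
    -- and they form an open and dense set
    (∀ l : Fin (fullRankNumber (monomialFun n (2 * d))) → Fin n → ℝ,
      HasFullRankAt (monomialFun n (2 * d)) (fullRankNumber (monomialFun n (2 * d)))
        (fun _ => 1, l) →
      IsWaringBasePoint (2 * d) (fullRankNumber (monomialFun n (2 * d))) l) ∧
    IsOpen {l : Fin (fullRankNumber (monomialFun n (2 * d))) → Fin n → ℝ |
      HasFullRankAt (monomialFun n (2 * d)) (fullRankNumber (monomialFun n (2 * d)))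
        (fun _ => 1, l)} ∧
    Dense {l : Fin (fullRankNumber (monomialFun n (2 * d))) → Fin n → ℝ |
      HasFullRankAt (monomialFun n (2 * d)) (fullRankNumber (monomialFun n (2 * d)))
        (fun _ => 1, l)} := by

  have he : 2 * d ≠ 0 := by omega
  have hne := exponent_nonempty hn (2 * d)
  have hN := isLeast_sInf
    (fullRankNumbers_nonempty analyticAt_monomialFun (span_range_monomialFun n (2 * d)))
  obtain ⟨-, P, -, hP⟩ := hN.1
  have hl := hP.one analyticAt_monomialFun
  have h2N := hl.isWaringBasePoint.two_mul_mem_waringBounds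
  have hw := isLeast_sInf ⟨_, h2N⟩
  have hC := signedCaratheodoryBounds_projMonomialFun (n := n) he
  have heq : realWaringRank n (2 * d) = signedCaratheodoryNumber (projMonomialFun n (2 * d)) := by
    rw [realWaringRank, signedCaratheodoryNumber, hC]
  exact ⟨hw, heq ▸ hC ▸ hw, hN, heq, hN.2 (mem_fullRankNumbers_of_mem_waringBounds hn hw.1),
    hw.2 h2N, ⟨_, hl.isWaringBasePoint⟩, fun _ h => h.isWaringBasePoint,
    isOpen_hasFullRankAt_one analyticAt_monomialFun _,
    dense_hasFullRankAt_one analyticAt_monomialFun hl⟩
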